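/- Let $q$ be a prime power, let $H=(h_{ij})_{0\le i,j\le 3}$ be a $4\times 4$ Hermitian matrix over $\mathbb{F}_{q^2}$, that is, $H\neq 0$ and $h_{ij}=h_{ji}^{\,q}$ for all $i,j$, and suppose that $H$ has rank $3$. Let $P\mathcal{U}_2\subset\mathbb{P}^3$ be the corresponding rank $3$ Hermitian surface, the zero set of $$\sum_{i,j=0}^{3} h_{ij}\,x_i\,x_j^{\,q}$$ (a cone over a non-degenerate Hermitian curve, with vertex an $\mathbb{F}_{q^2}$-rational point $P$). Let $d\le q$, let $F\in\mathbb{F}_{q^2}[x_0,x_1,x_2,x_3]$ be a nonzero homogeneous polynomial of degree $d$, and let $V(F)\subset\mathbb{P}^3$ be its zero set. Then the number of $\mathbb{F}_{q^2}$-rational points common to $P\mathcal{U}_2$ and $V(F)$ satisfies $$\left|(P\mathcal{U}_2\cap V(F))(\mathbb{F}_{q^2})\right|\le 1+q^2\,d\,(q+1).$$ -/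

import Mathlib

open scoped LinearAlgebra.Projectivization

namespace HermitianCone

/-- The set of `K`-rational points, in projective space of dimension `n` over `K`, of the zero set
of a homogeneous polynomial `F` in `n + 1` variables with coefficients in `K`. -/
def rationalPoints {K : Type*} [Field K] {n : ℕ} (F : MvPolynomial (Fin (n + 1)) K) :
    Set (ℙ K (Fin (n + 1) → K)) :=
  {p | MvPolynomial.eval p.rep F = 0}

/-- For homogeneous `F`, membership may be tested on any homogeneous coordinates of the point. -/
theorem mk_mem_rationalPoints_iff {K : Type*} [Field K] {n d : ℕ}
    {F : MvPolynomial (Fin (n + 1)) K} (hF : F.IsHomogeneous d)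
    (v : Fin (n + 1) → K) (hv : v ≠ 0) :
    Projectivization.mk K v hv ∈ rationalPoints F ↔ MvPolynomial.eval v F = 0 := by
  obtain ⟨a, ha⟩ := Projectivization.exists_smul_eq_mk_rep K v hv
  have h : MvPolynomial.eval (a • v) F = (a : K) ^ d * MvPolynomial.eval v F := by
    rw [MvPolynomial.eval_eq', MvPolynomial.eval_eq', Finset.mul_sum]
    refine Finset.sum_congr rfl fun m hm => ?_
    have hdeg := hF (MvPolynomial.mem_support_iff.mp hm)
    have hsum : ∑ i, m i = d := by
      rw [← hdeg, Finsupp.weight_apply, Finsupp.sum_fintype _ _ (by simp)]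
      simp
    simp only [Units.smul_def, Pi.smul_apply, smul_eq_mul, mul_pow, Finset.prod_mul_distrib,
      Finset.prod_pow_eq_pow_sum, hsum]
    ring
  simp only [rationalPoints, Set.mem_ofPred_eq]
  rw [← ha, h]
  simp

/-- `H` is a Hermitian matrix over a field with `q ^ 2` elements: `H ≠ 0` and `Hᵀ = H^(q)`, where
`H^(q)` is obtained by raising every entry to the power `q`. -/
def IsHermitianMatrix {K : Type*} [Field K] {n : ℕ} (q : ℕ)
    (H : Matrix (Fin (n + 1)) (Fin (n + 1)) K) : Prop :=
  H ≠ 0 ∧ H.transpose = H.map (fun a => a ^ q)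

/-- The form `xᵀ H x^(q) = ∑ i j, h i j * x i * x j ^ q` whose zero set is the Hermitian variety
of `H`. -/
noncomputable def hermitianForm {K : Type*} [Field K] {n : ℕ} (q : ℕ)
    (H : Matrix (Fin (n + 1)) (Fin (n + 1)) K) : MvPolynomial (Fin (n + 1)) K :=
  ∑ i, ∑ j, MvPolynomial.C (H i j) * MvPolynomial.X i * MvPolynomial.X j ^ q

theorem hermitianForm_isHomogeneous {K : Type*} [Field K] {n : ℕ} (q : ℕ)
    (H : Matrix (Fin (n + 1)) (Fin (n + 1)) K) : (hermitianForm q H).IsHomogeneous (q + 1) := by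
  refine MvPolynomial.IsHomogeneous.sum _ _ _ fun i _ =>
    MvPolynomial.IsHomogeneous.sum _ _ _ fun j _ => ?_
  have h := ((MvPolynomial.isHomogeneous_C (Fin (n + 1)) (H i j)).mul
    (MvPolynomial.isHomogeneous_X K i)).mul ((MvPolynomial.isHomogeneous_X K j).pow q)
  convert h using 1
  ring

end HermitianCone

namespace HermitianCone

open MvPolynomial

/-! Move the vertex to (1 : 0 : 0 : 0), so that the surface is the cone over a non-degenerate
Hermitian curve `h = 0` (`exists_cone_coordinates`). Write `F` as a polynomial in `x₀` of degree
`i`; its leading coefficient `G` is a ternary form of degree `e = d - i`. A generator of the cone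
over a point `w` of the curve carries, apart from the vertex, at most `i` points of `F = 0` if `G(w)
≠ 0`, and at most `q²` otherwise. The curve has at most `q²(q + 1)` points, at most `e(q + 1)` of
them on `G = 0`, so the total is at most `1 + q²(q + 1)i + q²(q + 1)e`.

The two bounds for the curve come from a Bézout inequality (`card_le_of_isRelPrime`), proved by
comparing dimensions of spaces of forms, and from irreducibility of `h`
(`hermitianForm_irreducible`). If `h = D * E`, the product rule puts the partial derivatives of `h`,
hence every `x_j ^ q`, in the ideal `(D, E)`; that ideal would then contain all forms of large
degree, contradicting its codimension of at least `deg D * deg E`. -/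

/-! ### Dimension of spaces of ternary forms; factors of forms -/

theorem finrank_homogeneousSubmodule_fin_three (K : Type*) [Field K] (n : ℕ) :
    Module.finrank K (homogeneousSubmodule (Fin 3) K n) = (n + 2).choose 2 := by
  classical
  have hset : {d : Fin 3 →₀ ℕ | d.degree = n} =
      (Finset.finsuppAntidiag (Finset.univ : Finset (Fin 3)) n : Set (Fin 3 →₀ ℕ)) := by
    ext d
    simp [Finsupp.degree_eq_sum]
  have h := homogeneousSubmodule_eq_finsupp_supported (Fin 3) K n
  rw [hset] at h
  rw [LinearEquiv.finrank_eq ((LinearEquiv.ofEq _ _ h).trans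
    (AddMonoidAlgebra.supportedEquivFinsupp (R := K) _)), Module.finrank_finsupp_self,
    ← Nat.card_eq_fintype_card, Nat.card_eq_card_toFinset]
  simp only [Finset.toFinset_coe, Finset.card_finsuppAntidiag_nat_eq_choose, Finset.card_univ,
    Fintype.card_fin]
  rw [show 3 + n - 1 = n + 2 by omega, Nat.choose_symm_add]

instance finite_homogeneousSubmodule (K : Type*) [Field K] (n : ℕ) :
    Module.Finite K (homogeneousSubmodule (Fin 3) K n) :=
  Module.Finite.iff_fg.mpr (homogeneousSubmodule_fg (Fin 3) K n)

/-- The lowest degree occurring in `A` is attained. -/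
theorem exists_order_eq {σ K : Type*} [Field K] {A : MvPolynomial σ K} (hA : A ≠ 0) :
    ∃ p : ℕ, (p : ℕ∞) = (A : MvPowerSeries σ K).order ∧ p ≤ A.totalDegree ∧
      (p = A.totalDegree → A.IsHomogeneous p) := by
  have h1 : (A : MvPowerSeries σ K) ≠ 0 := by simpa using hA
  have h2 := MvPowerSeries.ne_zero_iff_order_finite.mp h1
  refine ⟨_, h2, ?_, fun h m hm => ?_⟩
  · obtain ⟨d, hd, hd'⟩ := MvPowerSeries.exists_coeff_ne_zero_and_order h2
    rw [← hd', ENat.toNat_natCast]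
    rw [coeff_coe] at hd
    exact le_totalDegree (mem_support_iff.mpr hd)
  · change Finsupp.weight (fun _ => 1) m = _
    rw [← Finsupp.degree_eq_weight_one]
    have h3 : m.degree ≤ A.totalDegree := le_totalDegree (mem_support_iff.mpr hm)
    have h4 := MvPowerSeries.order_le (f := (A : MvPowerSeries σ K)) (d := m)
      (by rwa [coeff_coe])
    rw [← h2, Nat.cast_le] at h4
    exact le_antisymm (h3.trans h.ge) h4

/-- Over a domain both the lowest and the highest degrees add under multiplication. Both sums equal
`n`, so lowest and highest degree agree in each factor. -/
theorem exists_isHomogeneous_of_mul {σ K : Type*} [Field K] {A B : MvPolynomial σ K} {n : ℕ}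
    (h : (A * B).IsHomogeneous n) (hne : A * B ≠ 0) :
    ∃ r s, r + s = n ∧ A.IsHomogeneous r ∧ B.IsHomogeneous s := by
  have hA := left_ne_zero_of_mul hne
  have hB := right_ne_zero_of_mul hne
  obtain ⟨p, hp, hpA, hhA⟩ := exists_order_eq hA
  obtain ⟨q, hq, hqB, hhB⟩ := exists_order_eq hB
  have hdeg := totalDegree_mul_of_isDomain hA hB
  rw [h.totalDegree hne] at hdeg
  have hcomp := MvPowerSeries.homogeneousComponent_mul_of_le_order hp.le hq.le
  have hne' : MvPowerSeries.homogeneousComponent (p + q)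
      ((A : MvPowerSeries σ K) * (B : MvPowerSeries σ K)) ≠ 0 := by
    rw [hcomp]
    exact mul_ne_zero (MvPowerSeries.homogeneousComponent_of_order hp)
      (MvPowerSeries.homogeneousComponent_of_order hq)
  rw [← coe_mul, MvPowerSeries.ne_zero_iff_exists_coeff_ne_zero_and_degree] at hne'
  obtain ⟨-, m, hm, -⟩ := hne'
  rw [MvPowerSeries.coeff_homogeneousComponent] at hm
  have hmpq : m.degree = p + q := by
    by_contra hc
    simp [hc] at hm
  rw [if_pos hmpq, coeff_coe] at hm
  have hmn : m.degree = n := by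
    by_contra hc
    exact hm (h.coeff_eq_zero hc)
  exact ⟨p, q, by omega, hhA (by omega), hhB (by omega)⟩

/-! ### Codimension of the ideal of two ternary forms -/

section codim

variable {K : Type*} [Field K]

/-- The multiples by `D` of the ternary forms of degree `n`. -/
noncomputable def formMultiples (D : MvPolynomial (Fin 3) K) (n : ℕ) :
    Submodule K (MvPolynomial (Fin 3) K) :=
  (homogeneousSubmodule (Fin 3) K n).map (LinearMap.mulLeft K D)

theorem mem_formMultiples {D P : MvPolynomial (Fin 3) K} {n : ℕ} :
    P ∈ formMultiples D n ↔ ∃ A : MvPolynomial (Fin 3) K, A.IsHomogeneous n ∧ D * A = P := by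
  simp [formMultiples]

instance finite_formMultiples (D : MvPolynomial (Fin 3) K) (n : ℕ) :
    Module.Finite K (formMultiples D n) :=
  inferInstanceAs (Module.Finite K ((homogeneousSubmodule (Fin 3) K n).map _))

theorem finrank_formMultiples {D : MvPolynomial (Fin 3) K} (hD : D ≠ 0) (n : ℕ) :
    Module.finrank K (formMultiples D n) = (n + 2).choose 2 := by
  rw [← finrank_homogeneousSubmodule_fin_three K n]
  exact (LinearEquiv.finrank_eq (Submodule.equivMapOfInjective (LinearMap.mulLeft K D)
    (mul_right_injective₀ hD) _)).symm

theorem formMultiples_le {D : MvPolynomial (Fin 3) K} {r : ℕ} (hD : D.IsHomogeneous r) (n : ℕ) :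
    formMultiples D n ≤ homogeneousSubmodule (Fin 3) K (r + n) := by
  intro P hP
  obtain ⟨A, hA, rfl⟩ := mem_formMultiples.mp hP
  exact hD.mul hA

/-- This inclusion needs no coprimality, so the resulting codimension bound applies to an arbitrary
factorization of the Hermitian form. -/
theorem formMultiples_mul_le_inf {D E : MvPolynomial (Fin 3) K} {r s : ℕ}
    (hD : D.IsHomogeneous r) (hE : E.IsHomogeneous s) (c : ℕ) :
    formMultiples (D * E) c ≤ formMultiples D (s + c) ⊓ formMultiples E (r + c) := by
  intro P hP
  obtain ⟨A, hA, rfl⟩ := mem_formMultiples.mp hP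
  exact ⟨mem_formMultiples.mpr ⟨E * A, hE.mul hA, by ring⟩,
    mem_formMultiples.mpr ⟨D * A, hD.mul hA, by ring⟩⟩

/-- From `D * A = E * B` coprimality gives `E ∣ A`, and the cofactor is again a form. -/
theorem inf_le_formMultiples_mul {D E : MvPolynomial (Fin 3) K} {s : ℕ}
    (hE : E.IsHomogeneous s) (hE0 : E ≠ 0) (hDE : IsRelPrime D E) (c b : ℕ) :
    formMultiples D (s + c) ⊓ formMultiples E b ≤ formMultiples (D * E) c := by
  rintro P ⟨h1, h2⟩
  obtain ⟨A, hA, rfl⟩ := mem_formMultiples.mp h1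
  obtain ⟨B, -, hB⟩ := mem_formMultiples.mp h2
  obtain ⟨C, rfl⟩ := hDE.symm.dvd_of_dvd_mul_left (Dvd.intro B hB)
  rw [mem_formMultiples]
  by_cases hC : C = 0
  · exact ⟨0, isHomogeneous_zero _ _ _, by simp [hC]⟩
  · obtain ⟨s', c', hsum, hE', hC'⟩ := exists_isHomogeneous_of_mul hA (mul_ne_zero hE0 hC)
    have hs := hE.inj_right hE' hE0
    obtain rfl : c' = c := by omega
    exact ⟨C, hC', by ring⟩

/-- The alternating sum of dimensions in the Koszul complex of forms of degrees `r` and `s`. -/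
theorem choose_two_identity (r s c : ℕ) :
    (c + 2).choose 2 + (r + (s + c) + 2).choose 2 =
      (s + c + 2).choose 2 + (r + c + 2).choose 2 + r * s := by
  have h (n : ℕ) : 2 * (n + 2).choose 2 = (n + 2) * (n + 1) := by
    rw [Nat.choose_two_right, Nat.mul_div_cancel' (Nat.even_mul_pred_self _).two_dvd]
    rfl
  have h1 := h c
  have h2 := h (r + (s + c))
  have h3 := h (s + c)
  have h4 := h (r + c)
  nlinarith

/-- The forms of large degree in the ideal `(D, E)` have codimension at least `deg D * deg E`. -/
theorem finrank_sup_formMultiples_add_le {D E : MvPolynomial (Fin 3) K} {r s : ℕ}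
    (hD : D.IsHomogeneous r) (hE : E.IsHomogeneous s) (hD0 : D ≠ 0) (hE0 : E ≠ 0) (c : ℕ) :
    Module.finrank K ↥(formMultiples D (s + c) ⊔ formMultiples E (r + c)) + r * s ≤
      (r + (s + c) + 2).choose 2 := by
  have h1 := Submodule.finrank_sup_add_finrank_inf_eq (formMultiples D (s + c))
    (formMultiples E (r + c))
  have h2 := Submodule.finrank_mono (formMultiples_mul_le_inf hD hE c)
  rw [finrank_formMultiples hD0, finrank_formMultiples hE0] at h1
  rw [finrank_formMultiples (mul_ne_zero hD0 hE0)] at h2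
  have h3 := choose_two_identity r s c
  omega

/-- For coprime `D` and `E` the codimension is at most `deg D * deg E`. -/
theorem le_finrank_sup_formMultiples_add {D E : MvPolynomial (Fin 3) K} {r s : ℕ}
    (hE : E.IsHomogeneous s) (hD0 : D ≠ 0) (hE0 : E ≠ 0) (hDE : IsRelPrime D E) (c : ℕ) :
    (r + (s + c) + 2).choose 2 ≤
      Module.finrank K ↥(formMultiples D (s + c) ⊔ formMultiples E (r + c)) + r * s := by
  have h1 := Submodule.finrank_sup_add_finrank_inf_eq (formMultiples D (s + c))
    (formMultiples E (r + c))
  have h2 := Submodule.finrank_mono (inf_le_formMultiples_mul hE hE0 hDE c (r + c))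
  rw [finrank_formMultiples hD0, finrank_formMultiples hE0] at h1
  rw [finrank_formMultiples (mul_ne_zero hD0 hE0)] at h2
  have h3 := choose_two_identity r s c
  omega

end codim

/-! ### Interpolation at points and the Bézout inequality -/

section points

variable {K : Type*} [Field K]

/-- The linear form with coefficient vector `a`. -/
noncomputable def linearForm {n : ℕ} (a : Fin n → K) : MvPolynomial (Fin n) K :=
  ∑ i, C (a i) * X i

theorem linearForm_isHomogeneous {n : ℕ} (a : Fin n → K) : (linearForm a).IsHomogeneous 1 :=
  IsHomogeneous.sum _ _ _ fun _ _ => isHomogeneous_C_mul_X _ _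

@[simp]
theorem eval_linearForm {n : ℕ} (a v : Fin n → K) : eval v (linearForm a) = a ⬝ᵥ v := by
  simp [linearForm, dotProduct]

theorem linearForm_ne_zero {n : ℕ} {a : Fin n → K} (ha : a ≠ 0) : linearForm a ≠ 0 := by
  intro h
  apply ha
  funext i
  have := eval_linearForm a (Pi.single i 1)
  simpa [h] using this.symm

theorem exists_dotProduct_separating {n : ℕ} {u v : Fin n → K}
    (h : v ∉ Submodule.span K {u}) : ∃ a : Fin n → K, a ⬝ᵥ u = 0 ∧ a ⬝ᵥ v ≠ 0 := by
  obtain ⟨f, hf, hfu⟩ := Submodule.exists_le_ker_of_notMem h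
  refine ⟨fun i => f (Pi.single i 1), ?_, ?_⟩
  all_goals
    have key (w : Fin n → K) : (fun i => f (Pi.single i 1)) ⬝ᵥ w = f w := by
      conv_rhs => rw [LinearMap.pi_apply_eq_sum_univ f w]
      simp only [dotProduct, smul_eq_mul, mul_comm]
      congr! 4
      simp [Pi.single_apply, eq_comm]
    rw [key]
  · exact hfu (Submodule.mem_span_singleton_self u)
  · exact hf

theorem rep_notMem_span_rep {n : ℕ} {y z : ℙ K (Fin n → K)} (h : y ≠ z) :
    z.rep ∉ Submodule.span K {y.rep} := by
  intro hm
  obtain ⟨c, hc⟩ := Submodule.mem_span_singleton.mp hm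
  apply h
  rw [← Projectivization.mk_rep y, ← Projectivization.mk_rep z]
  exact ((Projectivization.mk_eq_mk_iff' K _ _ z.rep_nonzero y.rep_nonzero).mpr ⟨c, hc⟩).symm

/-- Finitely many points impose independent conditions on forms of large degree. -/
theorem exists_form_separating {n : ℕ} (Z : Finset (ℙ K (Fin n → K))) (z : ℙ K (Fin n → K))
    {t : ℕ} (ht : Z.card ≤ t) :
    ∃ P : MvPolynomial (Fin n) K, P.IsHomogeneous t ∧ eval z.rep P = 1 ∧
      ∀ y ∈ Z, y ≠ z → eval y.rep P = 0 := by
  classical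
  have hl (y : ℙ K (Fin n → K)) : ∃ a : Fin n → K, a ⬝ᵥ z.rep ≠ 0 ∧ (y ≠ z → a ⬝ᵥ y.rep = 0) := by
    by_cases hy : y = z
    · obtain ⟨a, -, ha⟩ := exists_dotProduct_separating (u := 0) (v := z.rep)
        (by simpa using z.rep_nonzero)
      exact ⟨a, ha, fun h => absurd hy h⟩
    · obtain ⟨a, ha0, ha⟩ := exists_dotProduct_separating (rep_notMem_span_rep hy)
      exact ⟨a, ha, fun _ => ha0⟩
  choose a ha ha0 using hl
  -- The last power, nonzero at `z`, only pads the degree to `t`.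
  set Q : MvPolynomial (Fin n) K := (∏ y ∈ Z, linearForm (a y)) * linearForm (a z) ^ (t - Z.card)
  have hQ : Q.IsHomogeneous t := by
    have h1 := IsHomogeneous.prod Z (fun y => linearForm (a y)) (fun _ => 1)
      fun y _ => linearForm_isHomogeneous (a y)
    have h2 := h1.mul ((linearForm_isHomogeneous (a z)).pow (t - Z.card))
    convert h2 using 1
    simp
    omega
  have hQz : eval z.rep Q ≠ 0 := by
    simp only [Q, map_mul, map_prod, map_pow, eval_linearForm]
    exact mul_ne_zero (Finset.prod_ne_zero_iff.mpr fun y _ => ha y) (pow_ne_zero _ (ha z))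
  refine ⟨C (eval z.rep Q)⁻¹ * Q, hQ.C_mul _, by simp [hQz], fun y hy hyz => ?_⟩
  have hQy : eval y.rep Q = 0 := by
    simp only [Q, map_mul, map_prod, map_pow, eval_linearForm]
    rw [Finset.prod_eq_zero hy (ha0 y hyz), zero_mul]
  rw [map_mul, hQy, mul_zero]

/-- Evaluation of polynomials at chosen coordinates of the points of `Z`. -/
noncomputable def evalPoints {n : ℕ} (Z : Finset (ℙ K (Fin n → K))) :
    MvPolynomial (Fin n) K →ₗ[K] (Z → K) :=
  LinearMap.pi fun z => (aeval (R := K) z.1.rep).toLinearMap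

theorem evalPoints_apply {n : ℕ} (Z : Finset (ℙ K (Fin n → K))) (P : MvPolynomial (Fin n) K)
    (z : Z) : evalPoints Z P z = eval z.1.rep P := by
  simp [evalPoints, aeval_eq_eval]

theorem evalPoints_domRestrict_surjective {n : ℕ} (Z : Finset (ℙ K (Fin n → K))) {t : ℕ}
    (ht : Z.card ≤ t) :
    Function.Surjective ((evalPoints Z).domRestrict (homogeneousSubmodule (Fin n) K t)) := by
  intro f
  choose P hP hP1 hP0 using fun z => exists_form_separating Z z ht
  refine ⟨∑ z : Z, f z • ⟨P z, hP z⟩, ?_⟩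
  funext y
  rw [map_sum, Finset.sum_apply, Finset.sum_eq_single y]
  · simp [evalPoints_apply, hP1]
  · intro z _ hzy
    simp [evalPoints_apply, hP0 z.1 y.1 y.2 fun h => hzy (Subtype.ext h.symm)]
  · simp

/-- The inequality in Bézout's theorem, for rational points of plane curves. -/
theorem card_le_of_isRelPrime {D E : MvPolynomial (Fin 3) K} {r s : ℕ}
    (hD : D.IsHomogeneous r) (hE : E.IsHomogeneous s) (hD0 : D ≠ 0) (hE0 : E ≠ 0)
    (hDE : IsRelPrime D E) (Z : Finset (ℙ K (Fin 3 → K)))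
    (hZ : ∀ z ∈ Z, eval z.rep D = 0 ∧ eval z.rep E = 0) : Z.card ≤ r * s := by
  set c := Z.card
  have h1 := le_finrank_sup_formMultiples_add (r := r) hE hD0 hE0 hDE c
  set f := (evalPoints Z).domRestrict (homogeneousSubmodule (Fin 3) K (r + (s + c)))
  have hsurj := evalPoints_domRestrict_surjective Z (t := r + (s + c)) (by omega)
  have h2 := LinearMap.finrank_range_add_finrank_ker f
  rw [LinearMap.range_eq_top.mpr hsurj, finrank_top, finrank_homogeneousSubmodule_fin_three,
    Module.finrank_fintype_fun_eq_card, Fintype.card_coe] at h2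
  -- The kernel of evaluation has codimension `Z.card` and contains the degree part of `(D, E)`,
  -- whose codimension is at most `r * s`.
  have h3 : formMultiples D (s + c) ⊔ formMultiples E (r + c) ≤
      (LinearMap.ker f).map (Submodule.subtype _) := by
    have hE' := formMultiples_le hE (r + c)
    rw [show s + (r + c) = r + (s + c) by ring] at hE'
    refine sup_le (fun P hP => ⟨⟨P, formMultiples_le hD _ hP⟩, ?_, rfl⟩)
      (fun P hP => ⟨⟨P, hE' hP⟩, ?_, rfl⟩)
    all_goals
      obtain ⟨A, -, rfl⟩ := mem_formMultiples.mp hP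
      refine LinearMap.mem_ker.mpr (funext fun z => ?_)
      simp [f, evalPoints_apply, hZ z.1 z.2]
  have h4 := Submodule.finrank_mono h3
  rw [Submodule.finrank_map_subtype_eq] at h4
  omega

end points

/-! ### Irreducibility of non-degenerate Hermitian curves -/

section irreducible

variable {K : Type*} [Field K]

theorem pderiv_hermitianForm {n q : ℕ} (hq : (q : K) = 0)
    (M : Matrix (Fin (n + 1)) (Fin (n + 1)) K) (k : Fin (n + 1)) :
    pderiv k (hermitianForm q M) = ∑ j, C (M k j) * X j ^ q := by
  classical
  have hq' : (q : MvPolynomial (Fin (n + 1)) K) = 0 := by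
    rw [← map_natCast C, hq, map_zero]
  simp only [hermitianForm, map_sum, pderiv_mul, pderiv_C, pderiv_pow, pderiv_X, hq']
  simp only [zero_mul, mul_zero, zero_add, add_zero]
  rw [Finset.sum_eq_single k]
  · simp
  · intro i _ hik
    simp [hik]
  · simp

/-- As `q = 0` in `K`, the gradient is `M` applied to the vector of `q`-th powers of the variables;
invert `M`. -/
theorem X_pow_eq_sum_pderiv_hermitianForm {n q : ℕ} (hq : (q : K) = 0)
    {M : Matrix (Fin (n + 1)) (Fin (n + 1)) K} (hM : M.det ≠ 0) (j : Fin (n + 1)) :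
    (X j ^ q : MvPolynomial (Fin (n + 1)) K) =
      ∑ i, C (M⁻¹ j i) * pderiv i (hermitianForm q M) := by
  classical
  have h1 : M⁻¹ * M = 1 := Matrix.nonsing_inv_mul _ (isUnit_iff_ne_zero.mpr hM)
  simp only [pderiv_hermitianForm hq, Finset.mul_sum, ← mul_assoc, ← C_mul]
  rw [Finset.sum_comm]
  simp only [← Finset.sum_mul, ← map_sum, ← Matrix.mul_apply, h1]
  rw [Finset.sum_eq_single j]
  · simp
  · intro i _ hij
    simp [Matrix.one_apply_ne' hij]
  · simp

theorem hermitianForm_ne_zero {n q : ℕ} (hq : (q : K) = 0)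
    {M : Matrix (Fin (n + 1)) (Fin (n + 1)) K} (hM : M.det ≠ 0) : hermitianForm q M ≠ 0 := by
  intro h
  have h1 := X_pow_eq_sum_pderiv_hermitianForm hq hM 0
  simp only [h, map_zero, mul_zero, Finset.sum_const_zero] at h1
  exact pow_ne_zero q (X_ne_zero 0) h1

theorem exists_le_of_mul_le_degree {q : ℕ} (m : Fin 3 →₀ ℕ) (h : 3 * q ≤ m.degree) :
    ∃ j, q ≤ m j := by
  by_contra! hc
  rw [Finsupp.degree_eq_sum, Fin.sum_univ_three] at h
  have := hc 0
  have := hc 1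
  have := hc 2
  omega

/-- The partial derivatives of the product `D * E` lie in the ideal `(D, E)`, so for a
non-degenerate Hermitian curve `D * E = 0` this ideal contains all forms of large degree. -/
theorem homogeneousSubmodule_le_sup_formMultiples {q r s : ℕ} (hq : (q : K) = 0)
    {M : Matrix (Fin (2 + 1)) (Fin (2 + 1)) K} (hM : M.det ≠ 0) {D E : MvPolynomial (Fin 3) K}
    (hD : D.IsHomogeneous (r + 1)) (hE : E.IsHomogeneous (s + 1))
    (hDE : D * E = hermitianForm q M) (hrs : r + 1 + (s + 1) = q + 1) :
    homogeneousSubmodule (Fin 3) K (r + 1 + (s + 1 + 3 * q)) ≤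
      formMultiples D (s + 1 + 3 * q) ⊔ formMultiples E (r + 1 + 3 * q) := by
  classical
  intro P hP
  rw [P.as_sum]
  refine Submodule.sum_mem _ fun m hm => ?_
  have hdeg : m.degree = r + 1 + (s + 1 + 3 * q) := by
    by_contra hc
    exact mem_support_iff.mp hm (IsHomogeneous.coeff_eq_zero hP hc)
  obtain ⟨j, hj⟩ := exists_le_of_mul_le_degree (q := q) m (by omega)
  obtain ⟨m', rfl⟩ : ∃ m', m = m' + Finsupp.single j q :=
    ⟨m - Finsupp.single j q, (tsub_add_cancel_of_le (Finsupp.single_le_iff.mpr hj)).symm⟩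
  have hdeg' : m'.degree = 3 * q + 1 := by
    rw [map_add, Finsupp.degree_single] at hdeg
    omega
  set c := coeff (m' + Finsupp.single j q) P
  have hN : (monomial m' c).IsHomogeneous (3 * q + 1) := isHomogeneous_monomial _ hdeg'
  have hmon : monomial (m' + Finsupp.single j q) c = monomial m' c * X j ^ q := by
    rw [X_pow_eq_monomial, monomial_mul, mul_one]
  rw [hmon, X_pow_eq_sum_pderiv_hermitianForm hq hM, Finset.mul_sum]
  refine Submodule.sum_mem _ fun i _ => ?_
  rw [← hDE, pderiv_mul]
  have hDi : (pderiv i D).IsHomogeneous r := hD.pderiv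
  have hEi : (pderiv i E).IsHomogeneous s := hE.pderiv
  have h1 : D * (monomial m' c * (C (M⁻¹ j i) * pderiv i E)) ∈ formMultiples D (s + 1 + 3 * q) :=
    mem_formMultiples.mpr ⟨_, by convert hN.mul (hEi.C_mul _) using 1; ring, rfl⟩
  have h2 : E * (monomial m' c * (C (M⁻¹ j i) * pderiv i D)) ∈ formMultiples E (r + 1 + 3 * q) :=
    mem_formMultiples.mpr ⟨_, by convert hN.mul (hDi.C_mul _) using 1; ring, rfl⟩
  convert Submodule.add_mem_sup h1 h2 using 1
  ring

theorem isUnit_of_isHomogeneous_zero {σ : Type*} {A : MvPolynomial σ K} (hA : A.IsHomogeneous 0)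
    (hA0 : A ≠ 0) : IsUnit A := by
  obtain ⟨a, rfl⟩ : ∃ a, A = C a :=
    ⟨_, totalDegree_eq_zero_iff_eq_C.mp ((totalDegree_zero_iff_isHomogeneous σ).mpr hA)⟩
  exact (isUnit_iff_ne_zero.mpr fun h => hA0 (by simp [h])).map C

/-- A non-degenerate Hermitian curve is irreducible. -/
theorem hermitianForm_irreducible {q : ℕ} (hq : (q : K) = 0)
    {M : Matrix (Fin (2 + 1)) (Fin (2 + 1)) K} (hM : M.det ≠ 0) :
    Irreducible (hermitianForm q M) := by
  have hne := hermitianForm_ne_zero hq hM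
  have hhom := hermitianForm_isHomogeneous q M
  refine ⟨fun hu => ?_, fun D E hDE => ?_⟩
  · have h1 := (isUnit_iff_totalDegree_of_isReduced.mp hu).2
    rw [hhom.totalDegree hne] at h1
    omega
  · rw [hDE] at hne hhom
    obtain ⟨r, s, hrs, hD, hE⟩ := exists_isHomogeneous_of_mul hhom hne
    have hD0 := left_ne_zero_of_mul hne
    have hE0 := right_ne_zero_of_mul hne
    rcases r with _ | r
    · exact Or.inl (isUnit_of_isHomogeneous_zero hD hD0)
    rcases s with _ | s
    · exact Or.inr (isUnit_of_isHomogeneous_zero hE hE0)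
    exfalso
    have h1 := finrank_sup_formMultiples_add_le hD hE hD0 hE0 (3 * q)
    have h2 := Submodule.finrank_mono
      (homogeneousSubmodule_le_sup_formMultiples hq hM hD hE hDE.symm hrs)
    rw [finrank_homogeneousSubmodule_fin_three] at h2
    have h3 : 0 < (r + 1) * (s + 1) := by positivity
    omega

/-- A non-degenerate Hermitian curve and a curve of degree `e ≤ q` have at most `e * (q + 1)`
common rational points. -/
theorem card_hermitian_inter_le {q e : ℕ} (hq : (q : K) = 0)
    {M : Matrix (Fin (2 + 1)) (Fin (2 + 1)) K} (hM : M.det ≠ 0) {G : MvPolynomial (Fin 3) K}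
    (hG : G.IsHomogeneous e) (hG0 : G ≠ 0) (he : e ≤ q) (Z : Finset (ℙ K (Fin 3 → K)))
    (hZ : ∀ z ∈ Z, eval z.rep (hermitianForm q M) = 0 ∧ eval z.rep G = 0) :
    Z.card ≤ e * (q + 1) := by
  have hne := hermitianForm_ne_zero hq hM
  have hhom := hermitianForm_isHomogeneous q M
  rw [mul_comm]
  refine card_le_of_isRelPrime hhom hG hne hG0 ?_ Z hZ
  rw [(hermitianForm_irreducible hq hM).isRelPrime_iff_not_dvd]
  intro hdvd
  have h1 := totalDegree_le_of_dvd_of_isDomain hdvd hG0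
  rw [hG.totalDegree hG0, hhom.totalDegree hne] at h1
  omega

end irreducible

/-! ### Counting points on the curve and on the cone -/

section counting

variable {K : Type*} [Field K] [Fintype K]

/-- The nonzero vectors representing the points of `S` are `q - 1` times as many as the points. -/
theorem ncard_vectors {V : Type*} [AddCommGroup V] [Module K V] (S : Set (ℙ K V)) :
    {v : V | ∃ h : v ≠ 0, Projectivization.mk K v h ∈ S}.ncard =
      S.ncard * (Fintype.card K - 1) := by
  classical
  have hne (p : ℙ K V) (c : Kˣ) : c • p.rep ≠ 0 := (smul_ne_zero_iff_ne c).mpr p.rep_nonzero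
  have hmk (p : ℙ K V) (c : Kˣ) : Projectivization.mk K (c • p.rep) (hne p c) = p := by
    conv_rhs => rw [← p.mk_rep]
    exact (Projectivization.mk_eq_mk_iff K _ _ _ _).mpr ⟨c, rfl⟩
  let f : S × Kˣ → {v : V | ∃ h : v ≠ 0, Projectivization.mk K v h ∈ S} := fun x =>
    ⟨x.2 • x.1.1.rep, hne _ _, by rw [hmk]; exact x.1.2⟩
  have hf : Function.Bijective f := by
    constructor
    · rintro ⟨⟨p, hp⟩, c⟩ ⟨⟨p', hp'⟩, c'⟩ h
      have h0 : c • p.rep = c' • p'.rep := congrArg Subtype.val h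
      have h1 : p = p' := by
        rw [← hmk p c, ← hmk p' c']
        congr 1
      subst h1
      have h2 : (c : K) = c' := smul_left_injective K p.rep_nonzero h0
      rw [Units.ext h2]
    · rintro ⟨v, hv, hvS⟩
      obtain ⟨a, ha⟩ := Projectivization.exists_smul_eq_mk_rep K v hv
      refine ⟨⟨⟨_, hvS⟩, a⁻¹⟩, Subtype.ext ?_⟩
      simp only [f, ← ha, inv_smul_smul]
  rw [← Nat.card_coe_set_eq, ← Nat.card_congr (Equiv.ofBijective f hf), Nat.card_prod,
    Nat.card_coe_set_eq, Nat.card_eq_fintype_card, Fintype.card_units]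

theorem card_dotProduct_eq_zero [DecidableEq K] {n : ℕ} {u : Fin (n + 1) → K} (hu : u ≠ 0) :
    (Finset.univ.filter fun a : Fin (n + 1) → K => a ⬝ᵥ u = 0).card = Fintype.card K ^ n := by
  classical
  let f : Module.Dual K (Fin (n + 1) → K) :=
    { toFun := fun a => a ⬝ᵥ u
      map_add' := fun a b => add_dotProduct a b u
      map_smul' := fun c a => smul_dotProduct c a u }
  have hf : f ≠ 0 := by
    intro h
    obtain ⟨i, hi⟩ := Function.ne_iff.mp hu
    have h1 : f (Pi.single i 1) = 0 := by rw [h, LinearMap.zero_apply]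
    exact hi (by simpa [f] using h1)
  have h1 := Module.Dual.finrank_ker_add_one_of_ne_zero hf
  rw [Module.finrank_fintype_fun_eq_card, Fintype.card_fin, Nat.add_right_cancel_iff] at h1
  have h2 := Module.card_eq_pow_finrank (K := K) (V := LinearMap.ker f)
  rw [h1] at h2
  rw [← h2, ← Fintype.card_subtype]
  exact Fintype.card_congr (Equiv.refl _)

theorem card_two_dotProduct_eq_zero [DecidableEq K] (u v : Fin 3 → K) :
    Fintype.card K - 1 ≤
      (Finset.univ.filter fun a : Fin 3 → K => a ≠ 0 ∧ a ⬝ᵥ u = 0 ∧ a ⬝ᵥ v = 0).card := by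
  classical
  -- Repeating `v` makes a singular square matrix; the nonzero multiples of a kernel vector suffice.
  obtain ⟨w, hw0, hw⟩ : ∃ w ≠ 0, (Matrix.of ![u, v, v]).mulVec w = 0 :=
    Matrix.exists_mulVec_eq_zero_iff.mpr
      (Matrix.det_zero_of_row_eq (i := 1) (j := 2) (by decide) rfl)
  have hu : w ⬝ᵥ u = 0 := by
    rw [dotProduct_comm]
    exact congrFun hw 0
  have hv : w ⬝ᵥ v = 0 := by
    rw [dotProduct_comm]
    exact congrFun hw 1
  rw [← Fintype.card_units, ← Finset.card_univ]
  refine Finset.card_le_card_of_injOn (fun c : Kˣ => (c : K) • w) (fun c _ => ?_) ?_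
  · simp [hw0, hu, hv]
  · intro c _ c' _ h
    exact Units.ext (smul_left_injective K hw0 h)

/-- A non-degenerate Hermitian curve has at most `q ^ 3 + q ^ 2` rational points: a line through
one of its points meets it in at most `q` further points. -/
theorem card_hermitian_points_le {q : ℕ} (hK : Fintype.card K = q ^ 2) (hq : (q : K) = 0)
    {M : Matrix (Fin (2 + 1)) (Fin (2 + 1)) K} (hM : M.det ≠ 0) (Z : Finset (ℙ K (Fin 3 → K)))
    (hZ : ∀ z ∈ Z, eval z.rep (hermitianForm q M) = 0) : Z.card ≤ q ^ 3 + q ^ 2 := by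
  classical
  have hq2 : 2 ≤ q := by
    have h1 : 1 < q ^ 2 := hK ▸ Fintype.one_lt_card
    by_contra! h
    interval_cases q <;> simp at h1
  rcases Z.eq_empty_or_nonempty with rfl | ⟨u, hu⟩
  · simp
  set T := Finset.univ.filter fun a : Fin 3 → K => a ≠ 0 ∧ a ⬝ᵥ u.rep = 0
  have hT : T.card = q ^ 4 - 1 := by
    have h1 := card_dotProduct_eq_zero (n := 2) u.rep_nonzero
    have h2 : T = (Finset.univ.filter fun a : Fin 3 → K => a ⬝ᵥ u.rep = 0).erase 0 := by
      ext a
      simp [T]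
    rw [h2, Finset.card_erase_of_mem (by simp), h1, hK, ← pow_mul]
  -- Double count pairs of a point `z ≠ u` and a nonzero linear form vanishing at `u` and `z`: each
  -- `z` has at least `q² - 1` forms, each form at most `q + 1` points including `u`.
  have hmul := Finset.card_mul_le_card_mul (s := Z.erase u) (t := T) (m := q ^ 2 - 1) (n := q)
    (fun z a => a ⬝ᵥ z.rep = 0) (fun z hz => ?_) (fun a ha => ?_)
  · rw [hT, Finset.card_erase_of_mem hu] at hmul
    have h4 : q ^ 4 - 1 = (q ^ 2 + 1) * (q ^ 2 - 1) := by
      have := Nat.sq_sub_sq (q ^ 2) 1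
      rwa [one_pow, ← pow_mul] at this
    have hpos : 0 < q ^ 2 - 1 := by
      have : 2 ^ 2 ≤ q ^ 2 := Nat.pow_le_pow_left hq2 2
      omega
    have h5 : Z.card - 1 ≤ (q ^ 2 + 1) * q := by
      refine Nat.le_of_mul_le_mul_right (hmul.trans_eq ?_) hpos
      rw [h4]
      ring
    have h6 : q + 1 ≤ q ^ 2 := by nlinarith
    have h7 : (q ^ 2 + 1) * q = q ^ 3 + q := by ring
    omega
  · rw [← hK]
    refine (card_two_dotProduct_eq_zero u.rep z.rep).trans (Finset.card_le_card fun a ha => ?_)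
    simp only [Finset.mem_filter, Finset.mem_univ, true_and] at ha
    simp [Finset.mem_bipartiteAbove, T, ha]
  · obtain ⟨ha0, hau⟩ : a ≠ 0 ∧ a ⬝ᵥ u.rep = 0 := by simpa [T] using ha
    have h1 := card_hermitian_inter_le hq hM (linearForm_isHomogeneous a) (linearForm_ne_zero ha0)
      (by omega) (Z.filter fun z => a ⬝ᵥ z.rep = 0) (fun z hz => by
        rw [Finset.mem_filter] at hz
        exact ⟨hZ z hz.1, by rw [eval_linearForm, hz.2]⟩)
    have h2 : (Z.erase u).bipartiteBelow (fun z a => a ⬝ᵥ z.rep = 0) a =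
        (Z.filter fun z => a ⬝ᵥ z.rep = 0).erase u := by
      ext z
      simp [Finset.mem_bipartiteBelow, and_assoc]
    rw [h2, Finset.card_erase_of_mem (by simp [hu, hau])]
    omega

/-- A bound on a set of points, stated for the coordinate vectors of these points. -/
theorem card_filter_vectors_le {n : ℕ} {p : (Fin (n + 1) → K) → Prop} [DecidablePred p] {B : ℕ}
    (S : Set (ℙ K (Fin (n + 1) → K))) (hp : ∀ v, p v ↔ ∃ h : v ≠ 0, Projectivization.mk K v h ∈ S)
    (hB : S.ncard ≤ B) : (Finset.univ.filter p).card ≤ B * (Fintype.card K - 1) := by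
  rw [← Set.ncard_coe_finset, Finset.coe_filter_univ]
  simp only [hp]
  rw [ncard_vectors]
  exact Nat.mul_le_mul_right _ hB

theorem ncard_le_of_forall_finset {n B : ℕ} (S : Set (ℙ K (Fin n → K)))
    (h : ∀ Z : Finset (ℙ K (Fin n → K)), (∀ z ∈ Z, z ∈ S) → Z.card ≤ B) : S.ncard ≤ B := by
  classical
  have hfin := Set.toFinite S
  rw [Set.ncard_eq_toFinset_card S hfin]
  exact h _ fun z hz => by simpa using hz

/-- The cone over a non-degenerate Hermitian curve, with vertex `(1 : 0 : 0 : 0)`, against a form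
of degree `d ≤ q`, counted by coordinate vectors. -/
theorem card_cone_vectors_le [DecidableEq K] {q d : ℕ} (hK : Fintype.card K = q ^ 2)
    (hq : (q : K) = 0) (hd : d ≤ q) {M : Matrix (Fin (2 + 1)) (Fin (2 + 1)) K} (hM : M.det ≠ 0)
    {F : MvPolynomial (Fin (3 + 1)) K} (hF : F.IsHomogeneous d) (hF0 : F ≠ 0) :
    (Finset.univ.filter fun y : Fin (3 + 1) → K =>
      y ≠ 0 ∧ eval (Fin.tail y) (hermitianForm q M) = 0 ∧ eval y F = 0).card ≤
      (1 + q ^ 2 * (d * (q + 1))) * (q ^ 2 - 1) := by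
  classical
  set Φ := finSuccEquiv K 3 F
  have hΦ0 : Φ ≠ 0 := (finSuccEquiv K 3).map_ne_zero_iff.mpr hF0
  set i := Φ.natDegree
  set G := Φ.leadingCoeff
  have hG0 : G ≠ 0 := Polynomial.leadingCoeff_ne_zero.mpr hΦ0
  have hid : i ≤ d := by
    rw [← hF.totalDegree hF0]
    exact (natDegree_finSuccEquiv F).trans_le (degreeOf_le_totalDegree F 0)
  obtain ⟨e, rfl⟩ := Nat.exists_eq_add_of_le hid
  have hG : G.IsHomogeneous e := hF.finSuccEquiv_coeff_isHomogeneous i e rfl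
  set h := hermitianForm q M
  have hh : h.IsHomogeneous (q + 1) := hermitianForm_isHomogeneous q M
  have hU : (Finset.univ.filter fun w : Fin (2 + 1) → K => w ≠ 0 ∧ eval w h = 0).card ≤
      (q ^ 3 + q ^ 2) * (q ^ 2 - 1) := by
    refine (card_filter_vectors_le (rationalPoints h) (fun w => ?_)
      (ncard_le_of_forall_finset _ fun Z hZ =>
        card_hermitian_points_le hK hq hM Z hZ)).trans_eq (by rw [hK])
    simp only [mk_mem_rationalPoints_iff hh, exists_prop]
  have hA : (Finset.univ.filter fun w : Fin (2 + 1) → K =>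
      w ≠ 0 ∧ eval w h = 0 ∧ eval w G = 0).card ≤ (e * (q + 1)) * (q ^ 2 - 1) := by
    refine (card_filter_vectors_le (rationalPoints h ∩ rationalPoints G) (fun w => ?_)
      (ncard_le_of_forall_finset _ fun Z hZ =>
        card_hermitian_inter_le hq hM hG hG0 (by omega) Z hZ)).trans_eq (by rw [hK])
    simp only [Set.mem_inter_iff, mk_mem_rationalPoints_iff hh, mk_mem_rationalPoints_iff hG,
      exists_prop]
  set S := Finset.univ.filter fun y : Fin (3 + 1) → K =>
      y ≠ 0 ∧ eval (Fin.tail y) h = 0 ∧ eval y F = 0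
  have hiq : i ≤ q ^ 2 := hid.trans (hd.trans (Nat.le_self_pow two_ne_zero q))
  -- The fibre over `w = 0` consists of the multiples of the vertex. The third term raises `i` to
  -- `q²` where the leading coefficient vanishes; `hiq` makes the subtraction exact.
  have hfib (w : Fin 3 → K) : (S.filter fun y => Fin.tail y = w).card ≤
      (if w = 0 then q ^ 2 - 1 else 0) + (if w ≠ 0 ∧ eval w h = 0 then i else 0) +
        (if w ≠ 0 ∧ eval w h = 0 ∧ eval w G = 0 then q ^ 2 - i else 0) := by
    have hle (R : Finset K) (hR : ∀ y ∈ S, Fin.tail y = w → y 0 ∈ R) :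
        (S.filter fun y => Fin.tail y = w).card ≤ R.card := by
      refine Finset.card_le_card_of_injOn (fun y => y 0) (fun y hy => ?_) fun y hy y' hy' hyy => ?_
      · rw [Finset.mem_coe, Finset.mem_filter] at hy
        exact hR y hy.1 hy.2
      · rw [Finset.mem_coe, Finset.mem_filter] at hy hy'
        rw [← Fin.cons_self_tail y, ← Fin.cons_self_tail y', hy.2, hy'.2]
        exact congrArg (fun t => (Fin.cons t w : Fin (3 + 1) → K)) hyy
    by_cases hw : w = 0
    · have h1 := hle (Finset.univ.erase 0) fun y hy hyw => by
        simp only [Finset.mem_erase, Finset.mem_univ, and_true]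
        intro hy0
        rw [Finset.mem_filter] at hy
        refine hy.2.1 ?_
        rw [← Fin.cons_self_tail y, hyw, hw, hy0]
        exact funext fun j => by cases j using Fin.cases <;> simp
      rw [Finset.card_erase_of_mem (Finset.mem_univ _), Finset.card_univ, hK] at h1
      simpa [hw] using h1
    by_cases hwh : eval w h = 0
    · by_cases hwG : eval w G = 0
      · have h1 := hle Finset.univ fun _ _ _ => Finset.mem_univ _
        rw [Finset.card_univ, hK] at h1
        simpa [hw, hwh, hwG, hiq] using h1
      -- The coefficient of index `i` specializes to `G(w) ≠ 0`, so root counting applies.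
      · have hmap : Φ.map (eval w) ≠ 0 := fun h0 => hwG (by
          have := congrArg (fun P => Polynomial.coeff P i) h0
          rw [Polynomial.coeff_map, Polynomial.coeff_zero] at this
          exact this)
        have h1 := hle (Φ.map (eval w)).roots.toFinset fun y hy hyw => by
          rw [Multiset.mem_toFinset, Polynomial.mem_roots hmap, Polynomial.IsRoot.def,
            ← eval_eq_eval_mv_eval', ← hyw, Fin.cons_self_tail]
          exact (Finset.mem_filter.mp hy).2.2.2
        have h2 := (Multiset.toFinset_card_le _).trans
          ((Polynomial.card_roots' (Φ.map (eval w))).trans Polynomial.natDegree_map_le)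
        simpa [hw, hwh, hwG] using h1.trans h2
    · have h1 := hle ∅ fun y hy hyw => absurd (hyw ▸ (Finset.mem_filter.mp hy).2.2.1) hwh
      simpa [hw, hwh] using h1
  rw [Finset.card_eq_sum_card_fiberwise (f := Fin.tail) (t := Finset.univ)
    (fun _ _ => Finset.mem_coe.mpr (Finset.mem_univ _))]
  refine (Finset.sum_le_sum fun w _ => hfib w).trans ?_
  rw [Finset.sum_add_distrib, Finset.sum_add_distrib, Finset.sum_ite_eq' Finset.univ,
    ← Finset.sum_filter, ← Finset.sum_filter, Finset.sum_const, Finset.sum_const,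
    if_pos (Finset.mem_univ _), smul_eq_mul, smul_eq_mul]
  calc _ ≤ (q ^ 2 - 1) + (q ^ 3 + q ^ 2) * (q ^ 2 - 1) * i +
        (e * (q + 1)) * (q ^ 2 - 1) * q ^ 2 :=
        add_le_add (Nat.add_le_add_left (Nat.mul_le_mul_right _ hU) _)
          (Nat.mul_le_mul hA (Nat.sub_le _ _))
    _ = _ := by ring

end counting

/-! ### Normal form of a rank 3 Hermitian surface -/

section normalForm

/-- Since `q` divides the prime power `|K|`, it is a power of the characteristic, so `a ↦ a ^ q` is
an iterated Frobenius; its square is `a ↦ a ^ |K|`. -/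
theorem exists_involutive_frobenius {K : Type*} [Field K] [Fintype K] {q : ℕ}
    (hK : Fintype.card K = q ^ 2) :
    (q : K) = 0 ∧ ∃ φ : K →+* K, (∀ a, φ a = a ^ q) ∧ ∀ a, φ (φ a) = a := by
  have hq0 : (q : K) = 0 := by
    have h := Nat.cast_card_eq_zero K
    rw [hK, Nat.cast_pow] at h
    exact pow_eq_zero_iff two_ne_zero |>.mp h
  obtain ⟨p, hp⟩ := CharP.exists K
  obtain ⟨n, hprime, hn⟩ := FiniteField.card K p
  have := Fact.mk hprime
  obtain ⟨k, -, rfl⟩ := (Nat.dvd_prime_pow hprime).mp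
    ((hn ▸ hK ▸ Dvd.intro_left q (sq q).symm : q ∣ p ^ (n : ℕ)))
  refine ⟨hq0, iterateFrobenius K p k, fun a => iterateFrobenius_def p k a, fun a => ?_⟩
  rw [iterateFrobenius_def, iterateFrobenius_def, ← pow_mul, ← sq, ← hK, FiniteField.pow_card]

variable {K : Type*} [Field K]

theorem eval_hermitianForm {n q : ℕ} (H : Matrix (Fin (n + 1)) (Fin (n + 1)) K)
    (v : Fin (n + 1) → K) :
    eval v (hermitianForm q H) = v ⬝ᵥ H.mulVec fun j => v j ^ q := by
  simp only [hermitianForm, map_sum, map_mul, eval_C, eval_X, map_pow, dotProduct, Matrix.mulVec,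
    Finset.mul_sum]
  refine Finset.sum_congr rfl fun i _ => Finset.sum_congr rfl fun j _ => ?_
  ring

theorem exists_matrix_mulVec_single {n : ℕ} {p : Fin (n + 1) → K} (hp : p ≠ 0) :
    ∃ P : Matrix (Fin (n + 1)) (Fin (n + 1)) K, P.det ≠ 0 ∧ P.mulVec (Pi.single 0 1) = p := by
  have he : (Pi.single 0 1 : Fin (n + 1) → K) ≠ 0 := by simp
  -- Extend the isomorphism between the two lines to an automorphism of the whole space.
  obtain ⟨g, hg⟩ := Submodule.exists_linearEquiv_restrict_eq
    ((LinearEquiv.toSpanNonzeroSingleton K _ _ he).symm.trans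
      (LinearEquiv.toSpanNonzeroSingleton K _ _ hp))
  refine ⟨LinearMap.toMatrix' g.toLinearMap, ?_, ?_⟩
  · rw [LinearMap.det_toMatrix']
    exact (LinearEquiv.isUnit_det' g).ne_zero
  · rw [← Matrix.toLin'_apply, Matrix.toLin'_toMatrix']
    have h1 := hg (LinearEquiv.toSpanNonzeroSingleton K _ _ he 1)
    rw [LinearEquiv.trans_apply, LinearEquiv.symm_apply_apply] at h1
    simpa using h1.symm

theorem eval_bind₁_linearForm {n : ℕ} (P : Matrix (Fin n) (Fin n) K) (F : MvPolynomial (Fin n) K)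
    (y : Fin n → K) :
    eval y (bind₁ (fun i => linearForm (P i)) F) = eval (P.mulVec y) F := by
  have h := aeval_bind₁ (R := K) y (fun i => linearForm (P i)) F
  simp only [aeval_eq_eval, eval_linearForm] at h
  exact h

/-- A matrix whose first row and column vanish has the rank of the remaining block. -/
theorem rank_le_rank_submatrix_succ {n : ℕ} {H : Matrix (Fin (n + 1)) (Fin (n + 1)) K}
    (hrow : ∀ j, H 0 j = 0) (hcol : ∀ i, H i 0 = 0) :
    H.rank ≤ (H.submatrix Fin.succ Fin.succ).rank := by
  set E : Matrix (Fin (n + 1)) (Fin n) K := Matrix.of fun i j => if i = j.succ then 1 else 0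
  have hE : H = E * (H.submatrix Fin.succ Fin.succ * E.transpose) := by
    ext i j
    cases i using Fin.cases with
    | zero => simp [Matrix.mul_apply, E, hrow, (Fin.succ_ne_zero _).symm]
    | succ i =>
      cases j using Fin.cases with
      | zero => simp [Matrix.mul_apply, E, hcol, (Fin.succ_ne_zero _).symm]
      | succ j => simp [Matrix.mul_apply, E, Fin.succ_inj]
  conv_lhs => rw [hE]
  exact (Matrix.rank_mul_le_right _ _).trans (Matrix.rank_mul_le_left _ _)

theorem det_ne_zero_of_le_rank {n : ℕ} {M : Matrix (Fin n) (Fin n) K} (h : n ≤ M.rank) :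
    M.det ≠ 0 := by
  intro h0
  obtain ⟨v, hv0, hv⟩ := Matrix.exists_mulVec_eq_zero_iff.mpr h0
  have h1 := LinearMap.finrank_range_add_finrank_ker M.mulVecLin
  rw [Module.finrank_fintype_fun_eq_card, Fintype.card_fin] at h1
  have h2 : n ≤ Module.finrank K (LinearMap.range M.mulVecLin) := h
  have h3 : Module.finrank K (LinearMap.ker M.mulVecLin) = 0 := by omega
  rw [Submodule.finrank_eq_zero] at h3
  have h4 : v ∈ LinearMap.ker M.mulVecLin := by simpa using hv
  rw [h3, Submodule.mem_bot] at h4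
  exact hv0 h4

/-- In coordinates with its vertex at `(1 : 0 : 0 : 0)`, a rank `3` Hermitian surface is the cone
over a non-degenerate Hermitian curve. -/
theorem exists_cone_coordinates {q : ℕ} {φ : K →+* K} (hφ : ∀ a, φ a = a ^ q)
    (hφφ : ∀ a, φ (φ a) = a) {H : Matrix (Fin (3 + 1)) (Fin (3 + 1)) K}
    (hH : H.transpose = H.map fun a => a ^ q) (hrank : H.rank = 3) :
    ∃ P : Matrix (Fin (3 + 1)) (Fin (3 + 1)) K, ∃ M : Matrix (Fin (2 + 1)) (Fin (2 + 1)) K,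
      P.det ≠ 0 ∧ M.det ≠ 0 ∧
      ∀ y, eval (P.mulVec y) (hermitianForm q H) = eval (Fin.tail y) (hermitianForm q M) := by
  have hdet : H.det = 0 := by
    by_contra h
    have := Matrix.rank_of_det_ne_zero h
    simp [hrank] at this
  obtain ⟨p, hp0, hp⟩ := Matrix.exists_vecMul_eq_zero_iff.mpr hdet
  obtain ⟨P, hP, hPp⟩ := exists_matrix_mulVec_single hp0
  have hmap (A : Matrix (Fin (3 + 1)) (Fin (3 + 1)) K) :
      (A.map fun a => a ^ q) = A.map φ := by
    ext i j
    simp [hφ]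
  have hPφ : (P.map φ).det ≠ 0 := by
    have h := RingHom.map_det φ P
    rw [RingHom.mapMatrix_apply] at h
    rw [← h]
    exact (map_ne_zero φ).mpr hP
  -- The form in the new coordinates. It is again Hermitian because `φ` is an involution, so its
  -- zero first row forces a zero first column.
  set N := P.transpose * H * P.map φ
  have hNt : N.transpose = N.map φ := by
    have h1 : (P.map φ).map φ = P := by
      ext i j
      simp [hφφ]
    have h2 : P.transpose.map φ = (P.map φ).transpose := rfl
    rw [Matrix.transpose_mul, Matrix.transpose_mul, hH, hmap, Matrix.transpose_transpose,
      Matrix.map_mul, Matrix.map_mul, h1, h2, Matrix.mul_assoc]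
  have hrow (j) : N 0 j = 0 := by
    have h1 : Matrix.vecMul (Pi.single 0 1) N = 0 := by
      rw [← Matrix.vecMul_vecMul, ← Matrix.vecMul_vecMul, Matrix.vecMul_transpose, hPp, hp,
        Matrix.zero_vecMul]
    have h2 := congrFun h1 j
    rwa [Matrix.single_one_vecMul] at h2
  have hcol (i) : N i 0 = 0 := by
    have h1 := congrFun (congrFun hNt 0) i
    rw [Matrix.transpose_apply, Matrix.map_apply, hrow, map_zero] at h1
    exact h1
  refine ⟨P, N.submatrix Fin.succ Fin.succ, hP, det_ne_zero_of_le_rank ?_, fun y => ?_⟩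
  · refine le_trans ?_ (rank_le_rank_submatrix_succ hrow hcol)
    rw [Matrix.rank_mul_eq_left_of_det_ne_zero _ _ hPφ,
      Matrix.rank_mul_eq_right_of_det_ne_zero _ _ (by rwa [Matrix.det_transpose]), hrank]
  · have h1 : (fun j => P.mulVec y j ^ q) = (P.map φ).mulVec fun j => y j ^ q := by
      funext j
      rw [← hφ, RingHom.map_mulVec]
      simp only [Function.comp_def, hφ]
    have h2 : eval (P.mulVec y) (hermitianForm q H) = y ⬝ᵥ N.mulVec fun j => y j ^ q := by
      rw [eval_hermitianForm, h1, ← Matrix.vecMul_transpose, ← Matrix.dotProduct_mulVec,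
        Matrix.mulVec_mulVec, Matrix.mulVec_mulVec]
    rw [h2, eval_hermitianForm]
    simp only [dotProduct, Matrix.mulVec]
    rw [Fin.sum_univ_succ]
    simp only [Fin.sum_univ_succ (n := 3), hrow, hcol, Fin.tail, Matrix.submatrix_apply]
    simp

end normalForm

end HermitianCone

/-! ### The bound for the surface -/

open HermitianCone in
theorem mainTheorem4 {K : Type*} [Field K] [Fintype K] (q d : ℕ)
    (hK : Fintype.card K = q ^ 2) (hd : d ≤ q)
    (H : Matrix (Fin (3 + 1)) (Fin (3 + 1)) K)
    (hH : HermitianCone.IsHermitianMatrix q H) (hrank : H.rank = 3)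
    (F : MvPolynomial (Fin (3 + 1)) K) (hF : F ≠ 0) (hFd : F.IsHomogeneous d) :
    (HermitianCone.rationalPoints (HermitianCone.hermitianForm q H) ∩
        HermitianCone.rationalPoints F).ncard ≤ 1 + q ^ 2 * (d * (q + 1)) := by
  classical
  obtain ⟨hq, φ, hφ, hφφ⟩ := exists_involutive_frobenius hK
  obtain ⟨P, M, hP, hM, hPM⟩ := exists_cone_coordinates hφ hφφ hH.2 hrank
  set F' := MvPolynomial.bind₁ (fun i => linearForm (P i)) F
  have hF' : F'.IsHomogeneous d := by
    have h := hFd.aeval (fun i => linearForm (P i)) fun i => linearForm_isHomogeneous (P i)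
    rwa [one_mul] at h
  have heval (y) : MvPolynomial.eval y F' = MvPolynomial.eval (P.mulVec y) F :=
    eval_bind₁_linearForm P F y
  have hPu : IsUnit P := (Matrix.isUnit_iff_isUnit_det P).mpr hP.isUnit
  have hinj : Function.Injective P.mulVec := Matrix.mulVec_injective_of_isUnit hPu
  have hsurj : Function.Surjective P.mulVec := Matrix.mulVec_surjective_iff_isUnit.mpr hPu
  -- Otherwise `F` would vanish on all of `K⁴`, impossible for a nonzero form of degree `d ≤ q ≤
  -- |K|`.
  have hF'0 : F' ≠ 0 := fun h => hF (hFd.eq_zero_of_forall_eval_eq_zero_of_le_card (fun v => by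
    obtain ⟨y, rfl⟩ := hsurj v
    rw [← heval, h, map_zero]) (by
    rw [Cardinal.mk_fintype, hK]
    exact_mod_cast hd.trans (Nat.le_self_pow two_ne_zero q)))
  have h1 := card_cone_vectors_le hK hq hd hM hF' hF'0
  have h2 := ncard_vectors (rationalPoints (hermitianForm q H) ∩ rationalPoints F)
  have hset : {v : Fin (3 + 1) → K | ∃ h : v ≠ 0, Projectivization.mk K v h ∈
      rationalPoints (hermitianForm q H) ∩ rationalPoints F} =
      P.mulVec '' (Finset.univ.filter fun y : Fin (3 + 1) → K => y ≠ 0 ∧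
        MvPolynomial.eval (Fin.tail y) (hermitianForm q M) = 0 ∧ MvPolynomial.eval y F' = 0) := by
    ext v
    obtain ⟨y, rfl⟩ := hsurj v
    rw [hinj.mem_set_image]
    have h0 : P.mulVec y ≠ 0 ↔ y ≠ 0 := by
      rw [← Matrix.mulVec_zero P, hinj.ne_iff, Matrix.mulVec_zero]
    simp only [Set.mem_inter_iff, mk_mem_rationalPoints_iff (hermitianForm_isHomogeneous q H),
      mk_mem_rationalPoints_iff hFd, exists_prop, Finset.coe_filter, Finset.mem_univ, true_and,
      Set.mem_ofPred_eq, hPM, heval, h0]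
  rw [hset, Set.ncard_image_of_injective _ hinj, Set.ncard_coe_finset, hK] at h2
  rw [h2] at h1
  have hpos : 0 < q ^ 2 - 1 := by
    have := hK ▸ Fintype.one_lt_card (α := K)
    omega
  exact Nat.le_of_mul_le_mul_right h1 hpos
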